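/- Let $n \ge 1$ and let $G$ and $H$ be quasi-isometric groups of type $FP_n(\mathbb{Z})$. Then $FV^n_{\mathbb{Z},G} \approx FV^n_{\mathbb{Z},H}$; moreover, if $n \ge 2$, both functions take only finite values. Here a group $\Gamma$ is of type $FP_n(\mathbb{Z})$ if the trivial $\mathbb{Z}\Gamma$-module $\mathbb{Z}$ has a projective resolution $P_* \to \mathbb{Z}$ with $P_i$ finitely generated for all $i \le n$. Two groups are quasi-isometric if they are quasi-isometric with respect to the word metrics of some finite generating sets. The function $FV^n_{\mathbb{Z},\Gamma} : \mathbb{R}_{\ge 0} \to [0,\infty]$ is computed from any projective resolution $P_* \to \mathbb{Z}$ over $\mathbb{Z}\Gamma$ in which $P_{n-1}$ and $P_n$ are finitely generated free modules with chosen bases: $$FV^n_{\mathbb{Z},\Gamma}(l) = \sup_{\substack{c \in P_{n-1},\ \partial c = 0\\ \|c\| \le l}}\ \ \inf_{\substack{b \in P_n\\ \partial b = c}} \|b\|,$$ where $\|\cdot\|$ is the $\ell^1$-norm: for a free $\mathbb{Z}\Gamma$-module with $\mathbb{Z}\Gamma$-basis $B$, $\|\sum_{\gamma \in \Gamma, b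 \in B} a_{\gamma b}\,\gamma b\| = \sum |a_{\gamma b}|$. For $n=1$, the condition $\partial c = 0$ means that $c$ lies in the kernel of the augmentation $P_0 \to \mathbb{Z}$. For functions $f,g : \mathbb{R}_{\ge 0} \to [0,\infty]$, $f \approx g$ means that $f \preccurlyeq g$ and $g \preccurlyeq f$, where $f \preccurlyeq g$ means that there are constants $C, D > 0$ with $f(v) \le C\,g(Cv+D) + Cv + D$ for all $v \ge 0$. The statement holds for every choice of such resolutions and bases for $G$ and for $H$. -/

import Mathlib

open CategoryTheory
open scoped NNReal ENNReal

universe u v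

noncomputable section

namespace FillingFunctions

/-! ### Groups as metric spaces -/

/-- The word length of `g` with respect to `S`: the least length of a word in the letters
`S ∪ S⁻¹` that represents `g`. (It is only used for generating sets `S`.) -/
def wordLength {Γ : Type*} [Group Γ] (S : Set Γ) (g : Γ) : ℕ :=
  sInf {k | ∃ w : List Γ, (∀ x ∈ w, x ∈ S ∨ x⁻¹ ∈ S) ∧ w.prod = g ∧ w.length = k}

/-- The (left-invariant) word metric with respect to `S`. -/
def wordDist {Γ : Type*} [Group Γ] (S : Set Γ) (g h : Γ) : ℝ :=
  wordLength S (g⁻¹ * h)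

/-- `f` is a quasi-isometry with respect to the distance functions `dX` and `dY`: a
quasi-isometric embedding with coarsely dense image. -/
def IsQuasiIsometry {X Y : Type*} (dX : X → X → ℝ) (dY : Y → Y → ℝ) (f : X → Y) : Prop :=
  ∃ K C : ℝ, 1 ≤ K ∧ 0 ≤ C ∧
    (∀ x x', K⁻¹ * dX x x' - C ≤ dY (f x) (f x') ∧ dY (f x) (f x') ≤ K * dX x x' + C) ∧
    ∀ y, ∃ x, dY (f x) y ≤ C

/-- Two groups are quasi-isometric if they have finite generating sets such that there is a
quasi-isometry between them for the associated word metrics. -/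
def QuasiIsometricGroups (G H : Type*) [Group G] [Group H] : Prop :=
  ∃ (S : Set G) (T : Set H), S.Finite ∧ T.Finite ∧
    Subgroup.closure S = ⊤ ∧ Subgroup.closure T = ⊤ ∧
    ∃ f : G → H, IsQuasiIsometry (wordDist S) (wordDist T) f

/-! ### Resolutions of the trivial module -/

/-- The trivial left `ℤΓ`-module `ℤ` (lifted to the universe of `Γ`). -/
abbrev trivialModule (Γ : Type u) [Group Γ] : ModuleCat.{u} (MonoidAlgebra ℤ Γ) :=
  ModuleCat.of (MonoidAlgebra ℤ Γ) (Representation.trivial ℤ Γ (ULift.{u} ℤ)).asModule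

/-- `Γ` is of type `FP_n(ℤ)`. -/
def IsFP (n : ℕ) (Γ : Type u) [Group Γ] : Prop :=
  ∃ P : ProjectiveResolution (trivialModule Γ),
    ∀ i ≤ n, Module.Finite (MonoidAlgebra ℤ Γ) (P.complex.X i)

/-- An `m`-admissible resolution: a projective `ℤΓ`-resolution `P_* → ℤ` of the trivial module
such that `P_m` and `P_{m+1}` are finitely generated free, with chosen bases. -/
structure AdmissibleResolution (m : ℕ) (Γ : Type u) [Group Γ] where
  /-- the projective resolution -/
  res : ProjectiveResolution (trivialModule Γ)
  /-- the rank of `P_m` -/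
  r : ℕ
  /-- the rank of `P_{m+1}` -/
  s : ℕ
  /-- the chosen basis of `P_m` -/
  basis : Module.Basis (Fin r) (MonoidAlgebra ℤ Γ) (res.complex.X m)
  /-- the chosen basis of `P_{m+1}` -/
  basisSucc : Module.Basis (Fin s) (MonoidAlgebra ℤ Γ) (res.complex.X (m + 1))

/-- The `ℓ¹`-norm on a free `ℤΓ`-module with `ℤΓ`-basis `b`, seen as a free `ℤ`-module with basis
`Γ b`: the sum of the absolute values of all integer coefficients. -/
def l1Norm {Γ : Type*} [Group Γ] {r : ℕ} {M : Type*} [AddCommGroup M]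
    [Module (MonoidAlgebra ℤ Γ) M] (b : Module.Basis (Fin r) (MonoidAlgebra ℤ Γ) M) (x : M) :
    ℝ≥0 :=
  ∑ i, ∑ γ ∈ (b.repr x i).coeff.support, ‖(b.repr x i).coeff γ‖₊

/-- The `i`-cycles of a resolution `P_* → ℤ`. In degree `0` the boundary map is the augmentation
`P_0 → ℤ`. -/
def IsCycle {Γ : Type u} [Group Γ] (P : ProjectiveResolution (trivialModule Γ)) :
    (i : ℕ) → P.complex.X i → Prop
  | 0, c => P.π.f 0 c = 0
  | i + 1, c => P.complex.d (i + 1) i c = 0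

namespace AdmissibleResolution

variable {m : ℕ} {Γ : Type u} [Group Γ]

/-- The filling volume of `c ∈ P_m`: the infimum of the norms of all `y ∈ P_{m+1}` with
`∂ y = c`. -/
def fillingVolume (P : AdmissibleResolution m Γ) (c : P.res.complex.X m) : ℝ≥0∞ :=
  ⨅ (y : P.res.complex.X (m + 1)) (_ : P.res.complex.d (m + 1) m y = c),
    (l1Norm P.basisSucc y : ℝ≥0∞)

/-- The integral homological filling function `FV^{m+1}_{ℤ,Γ}` computed from the `m`-admissible
resolution `P`: the supremum of the filling volumes of the `m`-cycles of norm at most `l`. -/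
def FV (P : AdmissibleResolution m Γ) (l : ℝ≥0) : ℝ≥0∞ :=
  ⨆ (c : P.res.complex.X m) (_ : IsCycle P.res m c) (_ : l1Norm P.basis c ≤ l),
    P.fillingVolume c

end AdmissibleResolution

/-! ### Comparison of functions -/

/-- `f ≼ g`: there are constants `C, D > 0` with `f v ≤ C g (C v + D) + C v + D` for all `v ≥ 0`.
-/
def Dominated (f g : ℝ≥0 → ℝ≥0∞) : Prop :=
  ∃ C D : ℝ≥0, 0 < C ∧ 0 < D ∧ ∀ v : ℝ≥0, f v ≤ C * g (C * v + D) + C * v + D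

/-- `f ≈ g`: both `f ≼ g` and `g ≼ f`. -/
def Equivalent (f g : ℝ≥0 → ℝ≥0∞) : Prop :=
  Dominated f g ∧ Dominated g f

end FillingFunctions

end

/-! A quasi-isometry is not equivariant, so it induces no linear chain map. The substitute is an
additive map `φ` that is `Controlled` over `f : G → H`: for each `x`, the elements `f(g)⁻¹ φ(g x)`
form a finite set as `g` varies. Such maps out of projective modules lift through surjections
(`Controlled.exists_lift`), so the comparison theorem for resolutions goes through: a quasi-inverse
pair of coarse maps gives `φ`, `ψ` and a homotopy `h` from `ψφ` to the identity, all controlled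
(`exists_controlled_homotopy`). Between finitely generated free modules controlled maps are
`ℓ¹`-bounded. To fill a cycle `c`, fill `φ c` by `y`; then `ψ' y - h c` fills `c`, where `ψ'` lifts
`ψ` one degree up. Boundedness is needed only in degrees `m` and `m + 1`, so lower degrees need not
be finitely generated.

For finiteness, let `m ≥ 1`. Cycles are then the kernel of a linear map to a projective module, and
the part of a cycle over a connected component of its support is again a cycle. Components of
bounded size lie, up to translation, in a fixed finite set, so cycles of bounded norm are sums of
boundedly many translates of finitely many cycles (`exists_finite_splitting`). -/

namespace FillingFunctions

/-! ### Coarse maps and controlled additive maps -/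

section Controlled

variable {G H K : Type*} [Group G] [Group H] [Group K]
variable {M N L : Type*} [AddCommGroup M] [AddCommGroup N] [AddCommGroup L]

/-- Translation by a group element on a module over the group ring. -/
noncomputable def translate [Module (MonoidAlgebra ℤ G) M] (g : G) : M →+ M :=
  DistribSMul.toAddMonoidHom M (MonoidAlgebra.of ℤ G g)

section translate
variable [Module (MonoidAlgebra ℤ G) M] [Module (MonoidAlgebra ℤ G) N]

lemma translate_apply (g : G) (x : M) : translate g x = MonoidAlgebra.of ℤ G g • x := rfl

@[simp] lemma translate_one (x : M) : translate (1 : G) x = x := by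
  simp only [translate_apply, map_one, one_smul]

lemma translate_translate (g h : G) (x : M) :
    translate g (translate h x) = translate (g * h) x := by
  simp only [translate_apply, map_mul, mul_smul]

@[simp] lemma translate_inv_translate (g : G) (x : M) : translate g⁻¹ (translate g x) = x := by
  simp [translate_translate]

@[simp] lemma translate_translate_inv (g : G) (x : M) : translate g (translate g⁻¹ x) = x := by
  simp [translate_translate]

lemma map_translate (φ : M →ₗ[MonoidAlgebra ℤ G] N) (g : G) (x : M) :
    φ (translate g x) = translate g (φ x) := by
  simp only [translate_apply, map_smul]

lemma single_smul_eq (g : G) (a : ℤ) (x : M) :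
    (MonoidAlgebra.single g a : MonoidAlgebra ℤ G) • x = a • translate g x := by
  rw [translate_apply, ← smul_assoc]
  congr 1
  simp [MonoidAlgebra.of_apply]

end translate

/-- A map between groups is coarse if it moves pairs of points that differ by a fixed element to
pairs of points that differ by elements of a finite set. -/
def Coarse (f : G → H) : Prop := ∀ k, (Set.range fun g => (f g)⁻¹ * f (g * k)).Finite

variable [Module (MonoidAlgebra ℤ G) M] [Module (MonoidAlgebra ℤ H) N]

/-- An additive map is controlled over `f` if, up to translation along `f`, it takes finitely many
values on the translates of each element. -/
def Controlled (f : G → H) (φ : M →+ N) : Prop :=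
  ∀ x, (Set.range fun g => translate (f g)⁻¹ (φ (translate g x))).Finite

variable {f : G → H}

lemma finite_range_translate_mul {ι : Type*} {a : ι → H} {z : ι → N}
    (ha : (Set.range a).Finite) (hz : (Set.range z).Finite) :
    (Set.range fun i => translate (a i) (z i)).Finite := by
  refine (ha.image2 (fun h y => translate h y) hz).subset ?_
  rintro _ ⟨i, rfl⟩
  exact ⟨_, ⟨i, rfl⟩, _, ⟨i, rfl⟩, rfl⟩

lemma finite_range_add {ι A : Type*} [Add A] {y z : ι → A}
    (hy : (Set.range y).Finite) (hz : (Set.range z).Finite) :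
    (Set.range fun i => y i + z i).Finite := by
  refine (hy.image2 (fun h y => h + y) hz).subset ?_
  rintro _ ⟨i, rfl⟩
  exact ⟨_, ⟨i, rfl⟩, _, ⟨i, rfl⟩, rfl⟩

lemma finite_range_comp {ι A B : Type*} {y : ι → A} (F : A → B)
    (hy : (Set.range y).Finite) : (Set.range fun i => F (y i)).Finite :=
  (hy.image F).subset (by rintro _ ⟨i, rfl⟩; exact ⟨_, ⟨i, rfl⟩, rfl⟩)

lemma Controlled.add {φ ψ : M →+ N} (hφ : Controlled f φ) (hψ : Controlled f ψ) :
    Controlled f (φ + ψ) := fun x => by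
  simpa using finite_range_add (hφ x) (hψ x)

lemma Controlled.neg {φ : M →+ N} (hφ : Controlled f φ) : Controlled f (-φ) := fun x => by
  simpa using finite_range_comp (fun y => -y) (hφ x)

lemma Controlled.sub {φ ψ : M →+ N} (hφ : Controlled f φ) (hψ : Controlled f ψ) :
    Controlled f (φ - ψ) := by
  simpa [sub_eq_add_neg] using hφ.add hψ.neg

lemma controlled_id : Controlled (id : G → G) (AddMonoidHom.id M) := fun x =>
  (Set.finite_singleton x).subset (by rintro _ ⟨g, rfl⟩; simp)

lemma Controlled.comp_linear [Module (MonoidAlgebra ℤ G) L] {φ : M →+ N}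
    (hφ : Controlled f φ) (l : L →ₗ[MonoidAlgebra ℤ G] M) :
    Controlled f (φ.comp l.toAddMonoidHom) := fun x => by
  simpa [map_translate] using hφ (l x)

lemma Controlled.comp [Module (MonoidAlgebra ℤ K) L] {f' : H → K} {φ : M →+ N} {ψ : N →+ L}
    (hψ : Controlled f' ψ) (hφ : Controlled f φ) : Controlled (f' ∘ f) (ψ.comp φ) := fun x => by
  refine ((hφ x).biUnion fun z _ => hψ z).subset ?_
  rintro _ ⟨g, rfl⟩
  simp only [Set.mem_iUnion]
  refine ⟨_, ⟨g, rfl⟩, ⟨f g, ?_⟩⟩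
  simp

/-- Used to regard `ψφ`, controlled over `f' ∘ f`, as controlled over the identity. -/
lemma Controlled.congr_fun {f' : G → H} {φ : M →+ N} (hφ : Controlled f φ)
    (h : (Set.range fun g => (f' g)⁻¹ * f g).Finite) : Controlled f' φ := fun x => by
  simpa [translate_translate] using finite_range_translate_mul h (hφ x)

/-- Controlled maps out of projective modules lift through surjections. -/
theorem Controlled.exists_lift [Module (MonoidAlgebra ℤ H) L]
    [Module.Projective (MonoidAlgebra ℤ G) M] (hf : Coarse f) {α : M →+ N} (hα : Controlled f α)
    (d : L →ₗ[MonoidAlgebra ℤ H] N) (hd : ∀ x, ∃ y, d y = α x) :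
    ∃ β : M →+ L, Controlled f β ∧ ∀ x, d (β x) = α x := by
  classical
  obtain ⟨s, hs⟩ := (Module.projective_def (R := MonoidAlgebra ℤ G) (P := M)).1 inferInstance
  -- A set-theoretic section `t` of `d`, with the junk value `0` off the image.
  have hd' : ∀ y, ∃ z, (∃ z, d z = y) → d z = y := fun y => by
    by_cases h : ∃ z, d z = y
    · exact ⟨h.choose, fun _ => h.choose_spec⟩
    · exact ⟨0, fun h' => (h h').elim⟩
  choose t ht using hd'
  have ht' : ∀ g x, d (t (translate (f g)⁻¹ (α x))) = translate (f g)⁻¹ (α x) := fun g x => by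
    obtain ⟨y, hy⟩ := hd x
    exact ht _ ⟨translate (f g)⁻¹ y, by rw [map_translate, hy]⟩
  -- Translate back by `f g` before applying `t`: for fixed `p`, the section then meets only
  -- finitely many arguments.
  let val (p : M) (g : G) : L := translate (f g) (t (translate (f g)⁻¹ (α (translate g p))))
  let β₀ : (M →₀ MonoidAlgebra ℤ G) →+ L := Finsupp.liftAddHom fun p =>
    (Finsupp.liftAddHom fun g => zmultiplesHom L (val p g)).comp
      MonoidAlgebra.coeffAddEquiv.toAddMonoidHom
  have hβ₀ : ∀ p g a, β₀ (Finsupp.single p (MonoidAlgebra.single g a)) = a • val p g := by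
    intro p g a
    simp [β₀]
  have hlift : ∀ x, d (β₀ x) = α (Finsupp.linearCombination (MonoidAlgebra ℤ G) id x) := by
    intro x
    induction x using Finsupp.induction_linear with
    | zero => simp
    | add x y hx hy => simp [hx, hy]
    | single p a =>
      induction a using MonoidAlgebra.induction_linear with
      | zero => simp
      | add x y hx hy => simp only [Finsupp.single_add, map_add, hx, hy]
      | single g a =>
        rw [hβ₀, map_zsmul, map_translate, ht']
        simp [single_smul_eq]
  have hcon : Controlled f β₀ := by
    intro x
    induction x using Finsupp.induction_linear with
    | zero => simp
    | add x y hx hy => simpa using finite_range_add hx hy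
    | single p a =>
      induction a using MonoidAlgebra.induction_linear with
      | zero => simp
      | add x y hx hy =>
        simp only [Finsupp.single_add, map_add]
        exact finite_range_add hx hy
      | single k a =>
        -- The value at `g * k` is translated by `f (g * k)` rather than `f g`; coarseness makes the
        -- discrepancy `(f g)⁻¹ * f (g * k)` range over a finite set.
        have h1 := finite_range_comp (fun y => a • y) (finite_range_translate_mul (hf k)
          (finite_range_comp t ((hα p).subset (Set.range_comp_subset_range (fun g => g * k) _))))
        convert h1 using 3 with g
        have : translate g (Finsupp.single p (MonoidAlgebra.single k a)) =
            Finsupp.single p (MonoidAlgebra.single (g * k) a : MonoidAlgebra ℤ G) := by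
          simp [translate_apply, MonoidAlgebra.of_apply, MonoidAlgebra.single_mul_single]
        rw [this, hβ₀, map_zsmul, translate_translate]
        rfl
  refine ⟨β₀.comp s.toAddMonoidHom, hcon.comp_linear s, fun x => ?_⟩
  have := hs x
  simp [hlift, this]

end Controlled

/-! ### The `ℓ¹`-norm and boundedness of controlled maps -/

section Norm

variable {G H : Type*} [Group G] [Group H] {r s : ℕ}
variable {M N : Type*} [AddCommGroup M] [AddCommGroup N]
variable [Module (MonoidAlgebra ℤ G) M] [Module (MonoidAlgebra ℤ H) N]
variable (b : Module.Basis (Fin r) (MonoidAlgebra ℤ G) M)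

lemma l1Norm_eq_sum {T : Finset G} {x : M} (hT : ∀ i, (b.repr x i).coeff.support ⊆ T) :
    l1Norm b x = ∑ i, ∑ γ ∈ T, ‖(b.repr x i).coeff γ‖₊ :=
  Finset.sum_congr rfl fun i _ => Finset.sum_subset (hT i) fun γ _ h => by
    simpa using h

lemma exists_support_subset (x : M) : ∃ T : Finset G, ∀ i, (b.repr x i).coeff.support ⊆ T := by
  classical
  exact ⟨Finset.univ.biUnion fun i => (b.repr x i).coeff.support, fun i =>
    Finset.subset_biUnion_of_mem (fun i => (b.repr x i).coeff.support) (Finset.mem_univ i)⟩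

@[simp] lemma l1Norm_zero : l1Norm b (0 : M) = 0 := by simp [l1Norm]

lemma l1Norm_add_le (x y : M) : l1Norm b (x + y) ≤ l1Norm b x + l1Norm b y := by
  classical
  obtain ⟨T, hT⟩ := exists_support_subset b x
  obtain ⟨T', hT'⟩ := exists_support_subset b y
  rw [l1Norm_eq_sum b (T := T ∪ T') fun i => (hT i).trans Finset.subset_union_left,
    l1Norm_eq_sum b (T := T ∪ T') fun i => (hT' i).trans Finset.subset_union_right,
    l1Norm_eq_sum b (x := x + y) (T := T ∪ T') fun i => ?_]
  · simp only [← Finset.sum_add_distrib]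
    gcongr
    simpa using nnnorm_add_le _ _
  · simpa using Finsupp.support_add.trans (Finset.union_subset_union (hT i) (hT' i))

@[simp] lemma l1Norm_neg (x : M) : l1Norm b (-x) = l1Norm b x := by
  simp [l1Norm]

lemma l1Norm_sum_le {ι : Type*} (t : Finset ι) (x : ι → M) :
    l1Norm b (∑ i ∈ t, x i) ≤ ∑ i ∈ t, l1Norm b (x i) :=
  Finset.le_sum_of_subadditive _ (l1Norm_zero b).le (l1Norm_add_le b) _ _

lemma l1Norm_zsmul (a : ℤ) (x : M) : l1Norm b (a • x) = ‖a‖₊ * l1Norm b x := by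
  obtain ⟨T, hT⟩ := exists_support_subset b x
  have h : b.repr (a • x) = a • b.repr x := map_zsmul b.repr.toAddMonoidHom a x
  rw [l1Norm_eq_sum b hT, l1Norm_eq_sum b (T := T) fun i => ?_]
  · simp [h, Finset.mul_sum, -zsmul_eq_mul]
  · rw [h]
    exact Finsupp.support_smul.trans (hT i)

lemma repr_translate (g : G) (x : M) (i : Fin r) (γ : G) :
    (b.repr (translate g x) i).coeff γ = (b.repr x i).coeff (g⁻¹ * γ) := by
  simp [translate_apply, MonoidAlgebra.of_apply, MonoidAlgebra.coeff_single_mul_apply]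

@[simp] lemma l1Norm_translate (g : G) (x : M) : l1Norm b (translate g x) = l1Norm b x := by
  refine Finset.sum_congr rfl fun i _ => ?_
  refine Finset.sum_bij' (fun γ _ => g⁻¹ * γ) (fun γ _ => g * γ) ?_ ?_ ?_ ?_ ?_ <;>
  simp [repr_translate]

lemma eq_sum_translate (x : M) :
    x = ∑ i, ∑ γ ∈ (b.repr x i).coeff.support, (b.repr x i).coeff γ • translate γ (b i) := by
  conv_lhs => rw [← b.sum_repr x]
  refine Finset.sum_congr rfl fun i _ => ?_
  conv_lhs => rw [← MonoidAlgebra.sum_coeff_single (b.repr x i)]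
  rw [Finsupp.sum, Finset.sum_smul]
  exact Finset.sum_congr rfl fun γ _ => single_smul_eq _ _ _

/-- Controlled maps between finitely generated free modules are bounded. -/
lemma Controlled.exists_bound {f : G → H} {φ : M →+ N} (hφ : Controlled f φ)
    (b' : Module.Basis (Fin s) (MonoidAlgebra ℤ H) N) :
    ∃ C, ∀ x, l1Norm b' (φ x) ≤ C * l1Norm b x := by
  have h : ∀ i, ∃ C, ∀ g, l1Norm b' (φ (translate g (b i))) ≤ C := fun i => by
    obtain ⟨C, hC⟩ := ((hφ (b i)).image (l1Norm b')).bddAbove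
    exact ⟨C, fun g => hC ⟨_, ⟨g, rfl⟩, by simp⟩⟩
  choose C hC using h
  refine ⟨∑ i, C i, fun x => ?_⟩
  conv_lhs => rw [eq_sum_translate b x]
  rw [map_sum]
  refine (l1Norm_sum_le _ _ _).trans ?_
  rw [l1Norm, Finset.mul_sum]
  gcongr with i
  rw [map_sum, Finset.mul_sum]
  refine (l1Norm_sum_le _ _ _).trans ?_
  gcongr with γ
  rw [map_zsmul, l1Norm_zsmul, mul_comm]
  gcongr
  exact (hC i γ).trans (Finset.single_le_sum (f := C) (fun _ _ => zero_le) (Finset.mem_univ i))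

end Norm

/-! ### Controlled chain maps, homotopies and comparison of filling functions -/

section Resolution

variable {G : Type u} {H : Type v} [Group G] [Group H]

lemma translate_trivialModule (g : G) (x : trivialModule G) : translate g x = x := by
  rw [translate_apply, MonoidAlgebra.of_apply]
  exact (Representation.single_smul (Representation.trivial ℤ G (ULift.{u} ℤ)) 1 g x).trans
    (one_smul ℤ _)

/-- The identification of the trivial modules of two groups with each other. -/
noncomputable def trivialModuleEquiv (G : Type u) (H : Type v) [Group G] [Group H] :
    trivialModule G ≃+ trivialModule H :=
  ((Representation.asModuleEquiv (Representation.trivial ℤ G (ULift.{u} ℤ))).toAddEquiv.trans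
    AddEquiv.ulift).trans
  ((Representation.asModuleEquiv (Representation.trivial ℤ H (ULift.{v} ℤ))).toAddEquiv.trans
    AddEquiv.ulift).symm

/-- The augmentation `P_0 → ℤ` of a resolution. -/
noncomputable def augmentation (P : ProjectiveResolution (trivialModule G)) :
    P.complex.X 0 →ₗ[MonoidAlgebra ℤ G] trivialModule G := (P.π.f 0).hom

lemma augmentation_surjective (P : ProjectiveResolution (trivialModule G)) :
    Function.Surjective (augmentation P) :=
  (ModuleCat.epi_iff_surjective (P.π.f 0)).1 inferInstance

/-- The boundary map of a resolution. -/
noncomputable def boundary (P : ProjectiveResolution (trivialModule G)) (n : ℕ) :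
    P.complex.X (n + 1) →ₗ[MonoidAlgebra ℤ G] P.complex.X n := (P.complex.d (n + 1) n).hom

/-- Exactness of the resolution; in degree `0` it holds because the augmentation is a cokernel of
`P_1 → P_0`. -/
lemma isCycle_iff (P : ProjectiveResolution (trivialModule G)) (n : ℕ) (c : P.complex.X n) :
    IsCycle P n c ↔ ∃ y, boundary P n y = c := by
  cases n with
  | zero =>
    let S := ShortComplex.mk _ _ P.complex_d_comp_π_f_zero
    have h : S.Exact := ShortComplex.exact_of_g_is_cokernel _ P.isColimitCokernelCofork
    exact ⟨S.moduleCat_exact_iff.1 h c, by rintro ⟨y, rfl⟩; exact S.moduleCat_zero_apply y⟩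
  | succ n =>
    let S := ShortComplex.mk _ _ (P.complex.d_comp_d (n + 2) (n + 1) n)
    exact ⟨S.moduleCat_exact_iff.1 (P.exact_succ n) c,
      by rintro ⟨y, rfl⟩; exact S.moduleCat_zero_apply y⟩

lemma isCycle_zero_iff (P : ProjectiveResolution (trivialModule G)) (c : P.complex.X 0) :
    IsCycle P 0 c ↔ augmentation P c = 0 := Iff.rfl

lemma isCycle_succ_iff (P : ProjectiveResolution (trivialModule G)) (n : ℕ)
    (c : P.complex.X (n + 1)) : IsCycle P (n + 1) c ↔ boundary P n c = 0 := Iff.rfl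

lemma isCycle_boundary (P : ProjectiveResolution (trivialModule G)) (n : ℕ)
    (c : P.complex.X (n + 1)) : IsCycle P n (boundary P n c) := (isCycle_iff P n _).2 ⟨c, rfl⟩

instance (P : ProjectiveResolution (trivialModule G)) (n : ℕ) :
    Module.Projective (MonoidAlgebra ℤ G) (P.complex.X n) :=
  ModuleCat.projective_of_module_projective _

lemma exists_controlled_lift_zero {f : G → H} (hf : Coarse f)
    (P : ProjectiveResolution (trivialModule G)) (Q : ProjectiveResolution (trivialModule H)) :
    ∃ φ : P.complex.X 0 →+ Q.complex.X 0, Controlled f φ ∧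
      ∀ x, augmentation Q (φ x) = trivialModuleEquiv G H (augmentation P x) := by
  refine Controlled.exists_lift hf
    (α := (trivialModuleEquiv G H).toAddMonoidHom.comp (augmentation P).toAddMonoidHom)
    (fun x => (Set.finite_singleton (trivialModuleEquiv G H (augmentation P x))).subset ?_)
    (augmentation Q) fun x => augmentation_surjective Q _
  rintro _ ⟨g, rfl⟩
  refine (translate_trivialModule _ _).trans (congrArg (trivialModuleEquiv G H) ?_)
  exact (map_translate (augmentation P) g x).trans (translate_trivialModule _ _)

lemma exists_controlled_lift_succ {f : G → H} (hf : Coarse f)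
    (P : ProjectiveResolution (trivialModule G)) (Q : ProjectiveResolution (trivialModule H))
    {n : ℕ} {φ : P.complex.X n →+ Q.complex.X n} (hφ : Controlled f φ)
    (hc : ∀ c, IsCycle P n c → IsCycle Q n (φ c)) :
    ∃ φ' : P.complex.X (n + 1) →+ Q.complex.X (n + 1), Controlled f φ' ∧
      ∀ x, boundary Q n (φ' x) = φ (boundary P n x) :=
  Controlled.exists_lift hf (hφ.comp_linear (boundary P n)) _ fun x =>
    (isCycle_iff Q n _).1 (hc _ (isCycle_boundary P n x))

/-- A quasi-inverse pair of coarse maps between groups induces maps between resolutions whose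
composition is chain homotopic to the identity by a controlled homotopy. -/
theorem exists_controlled_homotopy {f : G → H} {f' : H → G} (hf : Coarse f) (hf' : Coarse f')
    (hff' : (Set.range fun g => g⁻¹ * f' (f g)).Finite)
    (P : ProjectiveResolution (trivialModule G)) (Q : ProjectiveResolution (trivialModule H))
    (n : ℕ) : ∃ (φ : P.complex.X n →+ Q.complex.X n) (ψ : Q.complex.X n →+ P.complex.X n)
      (h : P.complex.X n →+ P.complex.X (n + 1)),
      Controlled f φ ∧ Controlled f' ψ ∧ Controlled (id : G → G) h ∧
      (∀ c, IsCycle P n c → IsCycle Q n (φ c)) ∧ (∀ c, IsCycle Q n c → IsCycle P n (ψ c)) ∧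
      ∀ c, IsCycle P n c → boundary P n (h c) = ψ (φ c) - c := by
  have hid : Coarse (id : G → G) := fun k =>
    (Set.finite_singleton k).subset (by rintro _ ⟨g, rfl⟩; simp)
  induction n with
  | zero =>
    obtain ⟨φ, hφ, hφa⟩ := exists_controlled_lift_zero hf P Q
    obtain ⟨ψ, hψ, hψa⟩ := exists_controlled_lift_zero hf' Q P
    obtain ⟨h, hh, hhb⟩ := Controlled.exists_lift hid
      (((hψ.comp hφ).congr_fun (f' := id) hff').sub controlled_id) (boundary P 0) fun x => by
        rw [← isCycle_iff, isCycle_zero_iff]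
        have : trivialModuleEquiv H G (trivialModuleEquiv G H (augmentation P x)) =
          augmentation P x := rfl
        simp [hφa, hψa, this]
    refine ⟨φ, ψ, h, hφ, hψ, hh, fun c hc => ?_, fun c hc => ?_, fun c _ => hhb c⟩
    · rw [isCycle_zero_iff] at hc ⊢
      rw [hφa, hc, map_zero]
    · rw [isCycle_zero_iff] at hc ⊢
      rw [hψa, hc, map_zero]
  | succ n ih =>
    obtain ⟨φ₀, ψ₀, h₀, hφ₀, hψ₀, hh₀, hφc, hψc, hhc⟩ := ih
    obtain ⟨φ, hφ, hφb⟩ := exists_controlled_lift_succ hf P Q hφ₀ hφc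
    obtain ⟨ψ, hψ, hψb⟩ := exists_controlled_lift_succ hf' Q P hψ₀ hψc
    -- The map `ψφ - 1 - h₀∂` lands in cycles, since `∂h₀ = ψ₀φ₀ - 1` on boundaries. On cycles the
    -- term `h₀∂` vanishes.
    obtain ⟨h, hh, hhb⟩ := Controlled.exists_lift hid
      ((((hψ.comp hφ).congr_fun (f' := id) hff').sub controlled_id).sub
        (hh₀.comp_linear (boundary P n))) (boundary P (n + 1)) fun x => by
        rw [← isCycle_iff, isCycle_succ_iff]
        simp [hφb, hψb, hhc _ (isCycle_boundary P n x)]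
    refine ⟨φ, ψ, h, hφ, hψ, hh, fun c hc => ?_, fun c hc => ?_, fun c hc => ?_⟩
    · rw [isCycle_succ_iff] at hc ⊢
      rw [hφb, hc, map_zero]
    · rw [isCycle_succ_iff] at hc ⊢
      rw [hψb, hc, map_zero]
    · rw [isCycle_succ_iff] at hc
      simp [hhb, hc]

namespace AdmissibleResolution

variable {m : ℕ} (P : AdmissibleResolution m G) (Q : AdmissibleResolution m H)

lemma fillingVolume_boundary_le (y : P.res.complex.X (m + 1)) :
    P.fillingVolume (boundary P.res m y) ≤ l1Norm P.basisSucc y :=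
  iInf_le_of_le y (iInf_le _ rfl)

lemma exists_fillingVolume_lt {c : P.res.complex.X m} {t : ℝ≥0∞} (h : P.fillingVolume c < t) :
    ∃ y, boundary P.res m y = c ∧ (l1Norm P.basisSucc y : ℝ≥0∞) < t := by
  simp only [fillingVolume, iInf_lt_iff] at h
  obtain ⟨y, hy, hlt⟩ := h
  exact ⟨y, hy, hlt⟩

theorem dominated_of_coarse {f : G → H} {f' : H → G} (hf : Coarse f) (hf' : Coarse f')
    (hff' : (Set.range fun g => g⁻¹ * f' (f g)).Finite) : Dominated P.FV Q.FV := by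
  obtain ⟨φ, ψ, h, hφ, hψ, hh, hφc, hψc, hhc⟩ :=
    exists_controlled_homotopy hf hf' hff' P.res Q.res m
  obtain ⟨ψ', hψ', hψb⟩ := exists_controlled_lift_succ hf' Q.res P.res hψ hψc
  obtain ⟨A, hA⟩ := hφ.exists_bound P.basis Q.basis
  obtain ⟨B, hB⟩ := hψ'.exists_bound Q.basisSucc P.basisSucc
  obtain ⟨C, hC⟩ := hh.exists_bound P.basis P.basisSucc
  -- One constant for all three bounds; the `1` makes it positive.
  set E := A + B + C + 1 with hE
  have hAE : A ≤ E := by rw [hE, add_assoc, add_assoc]; exact le_self_add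
  have hBE : B ≤ E := by rw [hE, add_assoc, add_comm A, add_assoc]; exact le_self_add
  have hCE : C ≤ E := by rw [hE, add_comm _ C, add_assoc]; exact le_self_add
  have hE0 : 0 < E := by positivity
  refine ⟨E, E, hE0, hE0, fun l => iSup₂_le fun c hc => iSup_le fun hl => ?_⟩
  -- Only the finiteness of the right-hand side is wanted here; `ε` is discarded at the end.
  refine ENNReal.le_of_forall_pos_le_add fun ε hε hfin => ?_
  have hE0' : (E : ℝ≥0∞) ≠ 0 := by simpa using hE0.ne'
  have hFV : Q.FV (E * l + E) ≠ ⊤ := fun htop => by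
    simp [htop, ENNReal.mul_top hE0'] at hfin
  have hcl : l1Norm Q.basis (φ c) ≤ E * l + E :=
    (hA c).trans ((mul_le_mul' hAE hl).trans le_self_add)
  have hfill : Q.fillingVolume (φ c) ≤ Q.FV (E * l + E) :=
    le_iSup₂_of_le (φ c) (hφc c hc) (le_iSup_of_le hcl le_rfl)
  -- A filling within `1` of the infimum suffices: the error becomes `E` and goes into the additive
  -- constant.
  obtain ⟨y, hy, hyl⟩ := Q.exists_fillingVolume_lt
    (hfill.trans_lt (ENNReal.lt_add_right hFV one_ne_zero))
  have hb : boundary P.res m (ψ' y - h c) = c := by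
    rw [map_sub, hψb, hy, hhc c hc, sub_sub_cancel]
  have h1 : l1Norm P.basisSucc (ψ' y - h c) ≤ E * l1Norm Q.basisSucc y + E * l := by
    rw [sub_eq_add_neg]
    refine (l1Norm_add_le _ _ _).trans (add_le_add ((hB y).trans ?_) ?_)
    · gcongr
    · rw [l1Norm_neg]
      exact (hC c).trans (mul_le_mul' hCE hl)
  have h2 : P.fillingVolume c ≤ l1Norm P.basisSucc (ψ' y - h c) := by
    simpa only [hb] using P.fillingVolume_boundary_le (ψ' y - h c)
  calc P.fillingVolume c ≤ (E * l1Norm Q.basisSucc y + E * l : ℝ≥0) :=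
        h2.trans (by exact_mod_cast h1)
    _ = E * (l1Norm Q.basisSucc y : ℝ≥0∞) + E * l := by push_cast; rfl
    _ ≤ E * (Q.FV (E * l + E) + 1) + E * l := by gcongr
    _ = E * Q.FV (E * l + E) + E * l + E := by ring
    _ ≤ _ := le_self_add

end AdmissibleResolution

end Resolution
-- From quasi-isometries to coarse maps
section WordMetric

variable {G H : Type*} [Group G] [Group H]

lemma finite_wordLength_le {S : Set G} (hS : S.Finite) (hgen : Subgroup.closure S = ⊤) (N : ℕ) :
    {g | wordLength S g ≤ N}.Finite := by
  have hA : (S ∪ S⁻¹).Finite := hS.union hS.inv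
  have := hA.to_subtype
  refine ((List.finite_length_le (S ∪ S⁻¹ : Set G) N).image
    fun w => (w.map Subtype.val).prod).subset fun g hg => ?_
  have hne : {k | ∃ w : List G, (∀ x ∈ w, x ∈ S ∨ x⁻¹ ∈ S) ∧ w.prod = g ∧ w.length = k}.Nonempty := by
    obtain ⟨w, hw, hwg⟩ := Submonoid.exists_list_of_mem_closure (s := S ∪ S⁻¹) (x := g) (by
      rw [← Subgroup.closure_toSubmonoid, hgen]; trivial)
    exact ⟨_, w, hw, hwg, rfl⟩
  obtain ⟨w, hw, hwg, hlen⟩ := Nat.sInf_mem hne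
  refine ⟨w.attach.map fun x => ⟨x.1, hw x.1 x.2⟩, ?_, ?_⟩
  · rw [Set.mem_ofPred_eq, List.length_map, List.length_attach, hlen]
    exact hg
  · simpa [List.map_map, Function.comp_def] using hwg

lemma finite_wordLength_le_real {S : Set G} (hS : S.Finite) (hgen : Subgroup.closure S = ⊤)
    (t : ℝ) : {g | (wordLength S g : ℝ) ≤ t}.Finite :=
  (finite_wordLength_le hS hgen ⌊t⌋₊).subset fun _ hg => Nat.le_floor hg

/-- Quasi-isometric groups are related by a quasi-inverse pair of coarse maps. -/
theorem QuasiIsometricGroups.exists_coarse (h : QuasiIsometricGroups G H) :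
    ∃ (f : G → H) (f' : H → G), Coarse f ∧ Coarse f' ∧
      (Set.range fun g => g⁻¹ * f' (f g)).Finite ∧ (Set.range fun h => h⁻¹ * f (f' h)).Finite := by
  obtain ⟨S, T, hS, hT, hSg, hTg, f, K, C, hK, -, hf, hdense⟩ := h
  choose f' hf' using hdense
  have hlip : Coarse f := fun k => by
    refine (finite_wordLength_le_real hT hTg (K * wordLength S k + C)).subset ?_
    rintro _ ⟨g, rfl⟩
    simpa [wordDist] using (hf g (g * k)).2
  -- The lower quasi-isometry bound: a finite set of differences in `H` comes from a finite set of
  -- differences in `G`.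
  have hproper : ∀ F : Set H, F.Finite → {k | ∃ p q, (f p)⁻¹ * f q ∈ F ∧ p⁻¹ * q = k}.Finite := by
    intro F hF
    obtain ⟨t, ht⟩ := (hF.image fun h => (wordLength T h : ℝ)).bddAbove
    refine (finite_wordLength_le_real hS hSg (K * (t + C))).subset ?_
    rintro _ ⟨p, q, hpq, rfl⟩
    have h1 := (hf p q).1
    have h2 : wordDist T (f p) (f q) ≤ t := ht ⟨_, hpq, rfl⟩
    have hK0 : 0 < K := by linarith
    rw [Set.mem_ofPred_eq, ← inv_mul_le_iff₀ hK0]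
    change K⁻¹ * wordDist S p q ≤ t + C
    linarith
  have hE : (Set.range fun h => (f (f' h))⁻¹ * h).Finite :=
    (finite_wordLength_le_real hT hTg C).subset (by rintro _ ⟨h, rfl⟩; exact hf' h)
  have hE' : (Set.range fun h => h⁻¹ * f (f' h)).Finite := by
    simpa using finite_range_comp (fun h => h⁻¹) hE
  refine ⟨f, f', hlip, fun k => ?_, ?_, hE'⟩
  -- `f(f'(h))⁻¹ f(f'(hk))` is the product of `f(f'(h))⁻¹ h`, `k` and `(hk)⁻¹ f(f'(hk))`, whose
  -- outer factors have finite range.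
  · refine (hproper _ ((hE.image2 (fun a b => a * k * b)) hE')).subset ?_
    rintro _ ⟨h, rfl⟩
    exact ⟨f' h, f' (h * k), ⟨_, ⟨h, rfl⟩, _, ⟨h * k, rfl⟩, by group⟩, rfl⟩
  · refine (hproper _ hE').subset ?_
    rintro _ ⟨g, rfl⟩
    exact ⟨g, f' (f g), ⟨f g, rfl⟩, rfl⟩

end WordMetric

/-! ### Supports and their connected components -/

lemma exists_eq_succ_of_card_le {α : Type*} {A : Finset α} {B : ℕ → Finset α} (hB : Monotone B)
    (hBA : ∀ k, B k ⊆ A) (h0 : (B 0).Nonempty) {n : ℕ} (hA : A.card ≤ n) :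
    ∃ k ≤ n, B k = B (k + 1) := by
  by_contra! h
  -- Strict growth from a nonempty start would put `n + 1` elements into `A`.
  have : ∀ k ≤ n, k + 1 ≤ (B k).card := by
    intro k
    induction k with
    | zero => intro _; simpa using h0.card_pos
    | succ k ih =>
      intro hk
      exact (Nat.succ_le_succ (ih (by omega))).trans
        (Finset.card_lt_card ((hB k.le_succ).ssubset_of_ne (h k (by omega))))
  have h1 := this n le_rfl
  have h2 := Finset.card_le_card (hBA n)
  omega

section Support

open scoped Pointwise

variable {G : Type*} [Group G] {ι κ : Type*}

/-- The set of group elements that occur in an element of a free module over the group ring. -/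
def groupSupport (x : ι →₀ MonoidAlgebra ℤ G) : Set G := {γ | ∃ i, (x i).coeff γ ≠ 0}

lemma finite_groupSupport (x : ι →₀ MonoidAlgebra ℤ G) : (groupSupport x).Finite := by
  refine (x.support.finite_toSet.biUnion fun i _ => (x i).coeff.support.finite_toSet).subset ?_
  rintro γ ⟨i, hi⟩
  simp only [Set.mem_iUnion]
  exact ⟨i, by simpa using fun h => hi (by simp [h]), by simpa using hi⟩

lemma groupSupport_smul_subset (a : MonoidAlgebra ℤ G) (y : ι →₀ MonoidAlgebra ℤ G) :
    groupSupport (a • y) ⊆ (a.coeff.support : Set G) * groupSupport y := by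
  classical
  rintro γ ⟨i, hi⟩
  have h : γ ∈ (a * y i).coeff.support := by simpa using hi
  obtain ⟨α, hα, β, hβ, rfl⟩ := Finset.mem_mul.1 (MonoidAlgebra.support_coeff_mul_subset a (y i) h)
  exact ⟨α, hα, β, ⟨i, by simpa using hβ⟩, rfl⟩

/-- By linearity, `S` can be the union of the supports of the images of the finitely many basis
vectors. -/
lemma exists_groupSupport_map_subset [Finite ι]
    (L : (ι →₀ MonoidAlgebra ℤ G) →ₗ[MonoidAlgebra ℤ G] (κ →₀ MonoidAlgebra ℤ G)) :
    ∃ S : Set G, S.Finite ∧ ∀ x, groupSupport (L x) ⊆ groupSupport x * S := by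
  refine ⟨⋃ i, groupSupport (L (Finsupp.single i 1)),
    Set.finite_iUnion fun i => finite_groupSupport _, fun x γ ⟨k, hk⟩ => ?_⟩
  have hx : L x = ∑ i ∈ x.support, x i • L (Finsupp.single i 1) := by
    conv_lhs => rw [← x.sum_single, Finsupp.sum, map_sum]
    refine Finset.sum_congr rfl fun i _ => ?_
    rw [← map_smul, Finsupp.smul_single, smul_eq_mul, mul_one]
  rw [hx, Finsupp.finsetSum_apply, MonoidAlgebra.coeff_sum, Finsupp.finsetSum_apply] at hk
  obtain ⟨i, -, hi⟩ := Finset.exists_ne_zero_of_sum_ne_zero hk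
  obtain ⟨α, hα, β, hβ, rfl⟩ := groupSupport_smul_subset (x i) (L (Finsupp.single i 1)) ⟨k, hi⟩
  exact ⟨α, ⟨i, by simpa using hα⟩, β, Set.mem_iUnion.2 ⟨i, hβ⟩, rfl⟩

open Classical in
/-- The part of an element of a free module that is supported on a given set of group elements. -/
noncomputable def restrictTo (B : Set G) (x : ι →₀ MonoidAlgebra ℤ G) : ι →₀ MonoidAlgebra ℤ G :=
  x.mapRange (fun y => .ofCoeff (y.coeff.filter (· ∈ B))) (by ext; simp [Finsupp.filter_apply])

open Classical in
lemma coeff_restrictTo (B : Set G) (x : ι →₀ MonoidAlgebra ℤ G) (i : ι) (γ : G) :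
    (restrictTo B x i).coeff γ = if γ ∈ B then (x i).coeff γ else 0 := by
  simp [restrictTo, Finsupp.filter_apply]

lemma restrictTo_add_compl (B : Set G) (x : ι →₀ MonoidAlgebra ℤ G) :
    restrictTo B x + restrictTo Bᶜ x = x := by
  classical
  ext i γ
  by_cases h : γ ∈ B <;> simp [coeff_restrictTo, h]

lemma groupSupport_restrictTo (B : Set G) (x : ι →₀ MonoidAlgebra ℤ G) :
    groupSupport (restrictTo B x) = groupSupport x ∩ B := by
  classical
  ext γ
  by_cases h : γ ∈ B <;> simp [groupSupport, coeff_restrictTo, h]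

/-- A union of connected components of a cycle is a cycle. -/
lemma exists_map_restrictTo_eq_zero [Finite ι]
    (L : (ι →₀ MonoidAlgebra ℤ G) →ₗ[MonoidAlgebra ℤ G] (κ →₀ MonoidAlgebra ℤ G)) :
    ∃ E : Set G, E.Finite ∧ ∀ x B, L x = 0 →
      (∀ γ ∈ groupSupport x ∩ B, ∀ γ' ∈ groupSupport x, γ⁻¹ * γ' ∈ E → γ' ∈ B) →
      L (restrictTo B x) = 0 := by
  obtain ⟨S, hS, hLS⟩ := exists_groupSupport_map_subset L
  -- If the images of the two parts fail to vanish, they cancel at some `a * s = a' * s'` with `a`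
  -- in `B` and `a'` outside. Then `a⁻¹ * a' = s * s'⁻¹` lies in `E`, so `a'` should be in `B`.
  refine ⟨S * S⁻¹, hS.mul hS.inv, fun x B hx hB => ?_⟩
  have hsum : L (restrictTo B x) + L (restrictTo Bᶜ x) = 0 := by
    rw [← map_add, restrictTo_add_compl, hx]
  by_contra hne
  obtain ⟨k, γ, hk⟩ : ∃ k γ, (L (restrictTo B x) k).coeff γ ≠ 0 := by
    by_contra! h
    exact hne (by ext k γ; simpa using h k γ)
  have hk' : (L (restrictTo Bᶜ x) k).coeff γ ≠ 0 := by
    rw [← neg_eq_of_add_eq_zero_right hsum]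
    simpa using hk
  obtain ⟨a, ha, s, hs, rfl⟩ := hLS _ ⟨k, hk⟩
  obtain ⟨a', ha', s', hs', h⟩ := hLS _ ⟨k, hk'⟩
  rw [groupSupport_restrictTo] at ha ha'
  refine ha'.2 (hB a ha a' ha'.1 ⟨s, hs, s'⁻¹, Set.inv_mem_inv.2 hs', ?_⟩)
  simp only at h ⊢
  rw [eq_inv_mul_iff_mul_eq, ← mul_assoc, ← h, mul_inv_cancel_right]

lemma finite_pow {E : Set G} (hE : E.Finite) (n : ℕ) : (E ^ n).Finite := by
  induction n with
  | zero => simp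
  | succ n ih => rw [pow_succ]; exact ih.mul hE

/-- The connected component of a point in a finite set of bounded size has bounded diameter. -/
lemma exists_component {E : Set G} {A : Finset G} {g : G} (hg : g ∈ A) {n : ℕ} (hA : A.card ≤ n) :
    ∃ B : Set G, g ∈ B ∧ (∀ γ ∈ B, g⁻¹ * γ ∈ (insert 1 E) ^ n) ∧
      ∀ γ ∈ (A : Set G) ∩ B, ∀ γ' ∈ A, γ⁻¹ * γ' ∈ E → γ' ∈ B := by
  classical
  have h1 : (1 : G) ∈ insert 1 E := Set.mem_insert _ _
  -- Balls around `g` for the steps in `E`, cut down to `A`; once two consecutive ones agree, they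
  -- are closed under steps within `A`.
  let B (k : ℕ) : Finset G := A.filter fun γ => g⁻¹ * γ ∈ (insert 1 E) ^ k
  have hB : Monotone B := fun j k hjk γ hγ => by
    simp only [B, Finset.mem_filter] at hγ ⊢
    exact ⟨hγ.1, Set.pow_subset_pow_right h1 hjk hγ.2⟩
  have hB0 : g ∈ B 0 := by simp [B, hg]
  obtain ⟨k, hk, hkk⟩ := exists_eq_succ_of_card_le hB (fun k => Finset.filter_subset _ _)
    ⟨g, hB0⟩ hA
  refine ⟨B k, hB (Nat.zero_le k) hB0, fun γ hγ => ?_, fun γ hγ γ' hγ' h => ?_⟩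
  · exact Set.pow_subset_pow_right h1 hk (Finset.mem_filter.1 hγ).2
  · rw [hkk]
    refine Finset.mem_coe.2 (Finset.mem_filter.2 ⟨hγ', ?_⟩)
    rw [pow_succ]
    exact ⟨_, (Finset.mem_filter.1 hγ.2).2, _, Set.mem_insert_of_mem _ h, by group⟩

end Support

/-! ### Splitting cycles into finitely many types -/

section Cluster

open scoped Pointwise

variable {G : Type*} [Group G] {r : ℕ} {M N : Type*} [AddCommGroup M] [AddCommGroup N]
variable [Module (MonoidAlgebra ℤ G) M] [Module (MonoidAlgebra ℤ G) N]
variable (b : Module.Basis (Fin r) (MonoidAlgebra ℤ G) M)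

lemma nnnorm_coeff_le_l1Norm (x : M) (i : Fin r) (γ : G) :
    ‖(b.repr x i).coeff γ‖₊ ≤ l1Norm b x := by
  classical
  obtain ⟨T, hT⟩ := exists_support_subset b x
  rw [l1Norm_eq_sum b (T := insert γ T) fun i => (hT i).trans (Finset.subset_insert _ _)]
  refine le_trans ?_ (Finset.single_le_sum (fun _ _ => zero_le) (Finset.mem_univ i))
  exact Finset.single_le_sum (f := fun γ => ‖(b.repr x i).coeff γ‖₊) (fun _ _ => zero_le)
    (Finset.mem_insert_self _ _)

lemma one_le_nnnorm_int {a : ℤ} (ha : a ≠ 0) : 1 ≤ ‖a‖₊ := by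
  rw [← NNReal.natCast_natAbs]
  exact_mod_cast Int.natAbs_pos.2 ha

lemma card_le_l1Norm {x : M} {A : Finset G} (hA : ∀ γ ∈ A, γ ∈ groupSupport (b.repr x)) :
    (A.card : ℝ≥0) ≤ l1Norm b x := by
  classical
  obtain ⟨T, hT⟩ := exists_support_subset b x
  rw [l1Norm_eq_sum b (T := A ∪ T) fun i => (hT i).trans Finset.subset_union_right,
    Finset.sum_comm, Finset.card_eq_sum_ones, Nat.cast_sum]
  refine le_trans ?_ (Finset.sum_le_sum_of_subset Finset.subset_union_left)
  refine Finset.sum_le_sum fun γ hγ => ?_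
  obtain ⟨i, hi⟩ := hA γ hγ
  rw [Nat.cast_one]
  exact (one_le_nnnorm_int hi).trans (Finset.single_le_sum
    (f := fun i => ‖(b.repr x i).coeff γ‖₊) (fun _ _ => zero_le) (Finset.mem_univ i))

lemma l1Norm_restrictTo_add (B : Set G) (x : M) :
    l1Norm b (b.repr.symm (restrictTo B (b.repr x))) +
      l1Norm b (b.repr.symm (restrictTo Bᶜ (b.repr x))) = l1Norm b x := by
  classical
  obtain ⟨T, hT⟩ := exists_support_subset b x
  have h : ∀ B : Set G, ∀ i,
      (b.repr (b.repr.symm (restrictTo B (b.repr x))) i).coeff.support ⊆ T := fun B i γ hγ => by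
    refine hT i ?_
    simp only [LinearEquiv.apply_symm_apply, Finsupp.mem_support_iff, coeff_restrictTo] at hγ ⊢
    exact fun h => hγ (by simp [h])
  rw [l1Norm_eq_sum b (h B), l1Norm_eq_sum b (h Bᶜ), l1Norm_eq_sum b hT]
  simp only [← Finset.sum_add_distrib, LinearEquiv.apply_symm_apply, coeff_restrictTo]
  refine Finset.sum_congr rfl fun i _ => Finset.sum_congr rfl fun γ _ => ?_
  by_cases hγ : γ ∈ B <;> simp [hγ]

lemma finite_setOf_l1Norm_le {F : Set G} (hF : F.Finite) (n : ℕ) :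
    {x | groupSupport (b.repr x) ⊆ F ∧ l1Norm b x ≤ n}.Finite := by
  have := hF.to_subtype
  have hfin : {v : Fin r × F → ℤ | ∀ p, v p ∈ Set.Icc (-n : ℤ) n}.Finite :=
    Set.Finite.pi' fun _ => Set.finite_Icc _ _
  refine Set.Finite.of_injOn (f := fun x (p : Fin r × F) => (b.repr x p.1).coeff p.2) ?_ ?_ hfin
  · intro x hx p
    have h := (nnnorm_coeff_le_l1Norm b x p.1 p.2).trans hx.2
    rw [← NNReal.natCast_natAbs, Nat.cast_le] at h
    exact abs_le.1 (by rw [Int.abs_eq_natAbs]; exact_mod_cast h)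
  · intro x hx y hy hxy
    apply b.repr.injective
    ext i γ
    by_cases hγ : γ ∈ F
    · exact congrFun hxy (i, ⟨γ, hγ⟩)
    · have h1 : (b.repr x i).coeff γ = 0 := by_contra fun h => hγ (hx.1 ⟨i, h⟩)
      have h2 : (b.repr y i).coeff γ = 0 := by_contra fun h => hγ (hy.1 ⟨i, h⟩)
      rw [h1, h2]

/-- Up to translation, finitely many cycles of norm at most `n` can be split off from all the
nonzero cycles of norm at most `n`. -/
theorem exists_finite_splitting [Module.Projective (MonoidAlgebra ℤ G) N]
    (D : M →ₗ[MonoidAlgebra ℤ G] N) (n : ℕ) :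
    ∃ K : Set M, K.Finite ∧ (∀ c ∈ K, D c = 0) ∧ ∀ c, D c = 0 → c ≠ 0 → l1Norm b c ≤ n →
      ∃ g : G, ∃ c₁ ∈ K, ∃ c₂, D c₂ = 0 ∧ c = translate g c₁ + c₂ ∧
        l1Norm b c₂ + 1 ≤ l1Norm b c := by
  -- The projective target embeds in a free module, so `L` has the same kernel and group supports
  -- make sense in its target.
  obtain ⟨s, hs⟩ := (Module.projective_def (R := MonoidAlgebra ℤ G) (P := N)).1 inferInstance
  let L := s ∘ₗ D ∘ₗ b.repr.symm.toLinearMap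
  have hL : ∀ x, L x = 0 ↔ D (b.repr.symm x) = 0 := fun x =>
    map_eq_zero_iff s hs.injective
  obtain ⟨E, hE, hsplit⟩ := exists_map_restrictTo_eq_zero L
  have hF : ((insert 1 E) ^ n).Finite := finite_pow (hE.insert 1) n
  refine ⟨_, (finite_setOf_l1Norm_le b hF n).inter_of_right {c | D c = 0}, fun c hc => hc.1,
    fun c hc hc0 hcn => ?_⟩
  obtain ⟨g, hg⟩ : (groupSupport (b.repr c)).Nonempty := by
    by_contra h
    refine hc0 (b.repr.injective ?_)
    ext i γ
    by_contra h'
    exact h ⟨γ, i, by simpa using h'⟩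
  set A := (finite_groupSupport (b.repr c)).toFinset with hA
  have hAcard : A.card ≤ n := by
    have := (card_le_l1Norm b (x := c) (A := A) (by simp [hA])).trans hcn
    exact_mod_cast this
  obtain ⟨B, hgB, hBE, hBA⟩ := exists_component (E := E) (A := A) (g := g) (by simpa [hA]) hAcard
  set y := b.repr.symm (restrictTo B (b.repr c)) with hy
  set z := b.repr.symm (restrictTo Bᶜ (b.repr c)) with hz
  have hyz : y + z = c := by
    rw [hy, hz, ← map_add, restrictTo_add_compl, LinearEquiv.symm_apply_apply]
  have hDy : D y = 0 := (hL _).1 (hsplit _ _ ((hL _).2 (by simpa using hc)) (by simpa [hA] using hBA))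
  have hnorm : l1Norm b y + l1Norm b z = l1Norm b c := l1Norm_restrictTo_add b B c
  have hysupp : groupSupport (b.repr y) = groupSupport (b.repr c) ∩ B := by
    rw [hy, LinearEquiv.apply_symm_apply, groupSupport_restrictTo]
  refine ⟨g, translate g⁻¹ y, ⟨?_, ?_, ?_⟩, z, ?_, ?_, ?_⟩
  · rw [Set.mem_ofPred_eq, map_translate, hDy, map_zero]
  · rintro γ ⟨i, hi⟩
    rw [repr_translate, inv_inv] at hi
    have h : g * γ ∈ groupSupport (b.repr y) := ⟨i, hi⟩
    rw [hysupp] at h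
    simpa using hBE _ h.2
  · rw [l1Norm_translate]
    exact (hnorm ▸ le_self_add : l1Norm b y ≤ l1Norm b c).trans hcn
  · have := congrArg D hyz
    rwa [map_add, hDy, hc, zero_add] at this
  · simp [hyz]
  · rw [← hnorm, add_comm]
    gcongr
    -- The split-off part has `g` in its support, hence norm at least `1`.
    have := card_le_l1Norm b (x := y) (A := {g}) (by simpa [hysupp] using ⟨hg, hgB⟩)
    simpa using this

end Cluster

/-! ### Finiteness of filling functions -/

namespace AdmissibleResolution

variable {m : ℕ} {G : Type u} [Group G] (P : AdmissibleResolution m G)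

lemma fillingVolume_lt_top {c : P.res.complex.X m} (hc : IsCycle P.res m c) :
    P.fillingVolume c < ⊤ := by
  obtain ⟨y, rfl⟩ := (isCycle_iff _ _ _).1 hc
  exact (P.fillingVolume_boundary_le y).trans_lt ENNReal.coe_lt_top

lemma fillingVolume_zero : P.fillingVolume 0 = 0 := by
  simpa using P.fillingVolume_boundary_le 0

lemma fillingVolume_add_le (c c' : P.res.complex.X m) :
    P.fillingVolume (c + c') ≤ P.fillingVolume c + P.fillingVolume c' := by
  refine ENNReal.le_of_forall_pos_le_add fun ε hε h => ?_
  have hε' : (ε / 2 : ℝ≥0∞) ≠ 0 := by simpa using hε.ne'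
  obtain ⟨hc, hc'⟩ := ENNReal.add_lt_top.1 h
  obtain ⟨y, rfl, hy⟩ := P.exists_fillingVolume_lt (ENNReal.lt_add_right hc.ne hε')
  obtain ⟨y', rfl, hy'⟩ := P.exists_fillingVolume_lt (ENNReal.lt_add_right hc'.ne hε')
  rw [← map_add]
  calc _ ≤ _ := P.fillingVolume_boundary_le (y + y')
    _ ≤ (l1Norm P.basisSucc y : ℝ≥0∞) + l1Norm P.basisSucc y' := by
        exact_mod_cast l1Norm_add_le _ _ _
    _ ≤ _ := add_le_add hy.le hy'.le
    _ = _ := by rw [add_add_add_comm, ENNReal.add_halves]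

lemma fillingVolume_translate_le (g : G) (c : P.res.complex.X m) :
    P.fillingVolume (translate g c) ≤ P.fillingVolume c := by
  refine le_of_forall_gt fun t ht => ?_
  obtain ⟨y, rfl, hy⟩ := P.exists_fillingVolume_lt ht
  rw [← map_translate]
  exact (P.fillingVolume_boundary_le _).trans_lt (by rwa [l1Norm_translate])

/-- Filling functions in degree at least two are finite. -/
theorem FV_lt_top {m : ℕ} (P : AdmissibleResolution (m + 1) G) (l : ℝ≥0) : P.FV l < ⊤ := by
  obtain ⟨K, hK, hKc, hsplit⟩ := exists_finite_splitting P.basis (boundary P.res m) ⌈l⌉₊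
  obtain ⟨C, hC⟩ : ∃ C : ℝ≥0, ∀ c ∈ K, P.fillingVolume c ≤ C := by
    obtain ⟨C, hC⟩ := (hK.image fun c => (P.fillingVolume c).toNNReal).bddAbove
    refine ⟨C, fun c hc => ?_⟩
    rw [← ENNReal.coe_toNNReal (P.fillingVolume_lt_top (hKc c hc)).ne]
    exact_mod_cast hC ⟨c, hc, rfl⟩
  -- Each piece split off costs at most `C` and lowers the norm by at least `1`.
  have key : ∀ k : ℕ, k ≤ ⌈l⌉₊ → ∀ c, boundary P.res m c = 0 → l1Norm P.basis c ≤ k →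
      P.fillingVolume c ≤ k * C := by
    intro k
    induction k with
    | zero =>
      intro hk c hc hck
      by_cases hc0 : c = 0
      · simp [hc0, fillingVolume_zero]
      · obtain ⟨g, c₁, -, c₂, -, -, h⟩ := hsplit c hc hc0 (hck.trans (by exact_mod_cast hk))
        have := (le_add_self.trans h).trans hck
        simp at this
    | succ k ih =>
      intro hk c hc hck
      by_cases hc0 : c = 0
      · simp [hc0, fillingVolume_zero]
      · obtain ⟨g, c₁, hc₁, c₂, hc₂, rfl, h⟩ :=
          hsplit c hc hc0 (hck.trans (by exact_mod_cast hk))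
        have h2 : l1Norm P.basis c₂ ≤ k := by
          have := h.trans hck
          rw [Nat.cast_succ] at this
          exact le_of_add_le_add_right this
        calc _ ≤ _ := P.fillingVolume_add_le _ _
          _ ≤ C + k * C := add_le_add ((P.fillingVolume_translate_le g c₁).trans (hC _ hc₁))
              (ih (by omega) c₂ hc₂ h2)
          _ = _ := by push_cast; ring
  refine (iSup₂_le fun c hc => iSup_le fun hl => key _ le_rfl c hc (hl.trans (Nat.le_ceil l))).trans_lt
    (b := (⌈l⌉₊ * C : ℝ≥0∞)) ?_
  exact_mod_cast ENNReal.coe_lt_top (r := ⌈l⌉₊ * C)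

end AdmissibleResolution

end FillingFunctions

theorem mainTheorem9 (G : Type u) (H : Type v) [Group G] [Group H] (m : ℕ)
    (hG : FillingFunctions.IsFP (m + 1) G) (hH : FillingFunctions.IsFP (m + 1) H)
    (hqi : FillingFunctions.QuasiIsometricGroups G H)
    (P : FillingFunctions.AdmissibleResolution m G)
    (Q : FillingFunctions.AdmissibleResolution m H) :
    FillingFunctions.Equivalent P.FV Q.FV ∧
      (1 ≤ m → ∀ l : NNReal, P.FV l < ⊤ ∧ Q.FV l < ⊤) := by
  obtain ⟨f, f', hf, hf', h, h'⟩ := hqi.exists_coarse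
  refine ⟨⟨P.dominated_of_coarse Q hf hf' h, Q.dominated_of_coarse P hf' hf h'⟩, fun hm l => ?_⟩
  cases m with
  | zero => omega
  | succ m => exact ⟨P.FV_lt_top l, Q.FV_lt_top l⟩
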